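/- Let $(V,V^+,e)$ be an AOU space: $V$ is a complex $*$-vector space, $V^+\subseteq V_h=\{x\in V: x^*=x\}$ is a cone with $V^+\cap(-V^+)=\{0\}$, and $e\in V_h$ is an Archimedean order unit, i.e. for every $x\in V_h$ there is a real $r>0$ with $re-x\in V^+$, and $x\in V^+$ whenever $re+x\in V^+$ for all real $r>0$. For $x,y\in V_h$ write $x\le y$ if $y-x\in V^+$, and let $\|x\|=\inf\{t\ge 0: -te\le x\le te\}$ be the order norm of $x\in V_h$. For $v\in V$ let $$\|v\|_{\mathrm{dec}}=\inf\Big\{\Big\|\sum_{j=1}^k|\lambda_j|v_j\Big\| : v=\sum_{j=1}^k\lambda_jv_j,\ \lambda_j\in\mathbb C,\ v_j\in V^+\Big\}.$$ Let $\mathrm{OMAX}(V)=(V,\{C_n^{\max}(V)\}_{n\ge1},e)$ be the maximal operator system structure on $V$, where $$C_n^{\max}(V)=\{A\in M_n(V): re_n+A\in D_n^{\max}(V)\text{ for all } r>0\},\qquad e_n=\mathrm{diag}(e,\dots,e),$$ $$D_n^{\max}(V)=\Big\{\sum_{i=1}^k a_i\otimes v_i : k\in\mathbb N,\ a_i\in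 M_n(\mathbb C)^+,\ v_i\in V^+\Big\},$$ and let $\|\cdot\|_{\mathrm{OMAX}(V)}$ be its operator system norm, $$\|v\|_{\mathrm{OMAX}(V)}=\inf\Big\{t\ge0:\begin{pmatrix}te&v\\v^*&te\end{pmatrix}\in C_2^{\max}(V)\Big\}.$$ Then for every $v\in V$, $$\|v\|_{\mathrm{dec}}=\|v\|_{\mathrm{OMAX}(V)}=\sup\{\|\phi(v)\| : \phi:V\to B(H)\},$$ where the supremum is taken over all complex Hilbert spaces $H$ and all unital positive linear maps $\phi:V\to B(H)$, that is, linear maps with $\phi(e)=I$ and $\phi(x)\ge0$ for all $x\in V^+$. -/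

import Mathlib

universe u w

namespace OMax

section

variable {V : Type u} [AddCommGroup V] [Module ℂ V] [StarAddMonoid V]

/-- `(V, P, e)` is an Archimedean order unit (AOU) space: `P` is a proper cone of hermitian
elements of the `*`-vector space `V`, and `e` is an Archimedean order unit. -/
structure IsAOUSpace (P : Set V) (e : V) : Prop where
  nonempty : P.Nonempty
  hermitian : ∀ x ∈ P, star x = x
  smul_mem : ∀ r : ℝ, 0 ≤ r → ∀ x ∈ P, (r : ℂ) • x ∈ P
  add_mem : ∀ x ∈ P, ∀ y ∈ P, x + y ∈ P
  proper : ∀ x, x ∈ P → -x ∈ P → x = 0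
  unit_hermitian : star e = e
  order_unit : ∀ x, star x = x → ∃ r : ℝ, 0 < r ∧ (r : ℂ) • e - x ∈ P
  archimedean : ∀ x, (∀ r : ℝ, 0 < r → (r : ℂ) • e + x ∈ P) → x ∈ P

/-- The order norm of a hermitian element, `inf {t : -t e ≤ x ≤ t e}`. The restriction `0 ≤ t`
is automatic unless `V = 0`, where it makes the infimum `0`. -/
noncomputable def orderNorm (P : Set V) (e x : V) : ℝ :=
  sInf {t : ℝ | 0 ≤ t ∧ x + (t : ℂ) • e ∈ P ∧ (t : ℂ) • e - x ∈ P}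

/-- The decomposition norm: the infimum of the order norms of `∑ |λ_j| v_j` over all
decompositions `v = ∑ λ_j v_j` with `λ_j ∈ ℂ` and `v_j ∈ P`. -/
noncomputable def decNorm (P : Set V) (e v : V) : ℝ :=
  sInf {t : ℝ | ∃ (k : ℕ) (l : Fin k → ℂ) (x : Fin k → V), (∀ j, x j ∈ P) ∧
    v = ∑ j, l j • x j ∧ t = orderNorm P e (∑ j, ((‖l j‖ : ℝ) : ℂ) • x j)}

open scoped ComplexOrder in
/-- The cone `D_n^max` of all finite sums `∑ a_i ⊗ x_i` with `a_i ∈ M_n(ℂ)` positive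
semidefinite and `x_i ∈ P`, where `a ⊗ x ∈ M_n(V)` has entries `a_{ij} x`. -/
def dMax (P : Set V) (n : ℕ) : Set (Matrix (Fin n) (Fin n) V) :=
  {A | ∃ (k : ℕ) (a : Fin k → Matrix (Fin n) (Fin n) ℂ) (x : Fin k → V),
    (∀ i, (a i).PosSemidef) ∧ (∀ i, x i ∈ P) ∧ A = ∑ i, (a i).map (fun z => z • x i)}

/-- The matrix cones `C_n^max` of `OMAX(V)`: all `A` with `r e_n + A ∈ D_n^max` for every
`r > 0`, where `e_n = diag(e, …, e)`. -/
def cMax (P : Set V) (e : V) (n : ℕ) : Set (Matrix (Fin n) (Fin n) V) :=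
  {A | ∀ r : ℝ, 0 < r → (r : ℂ) • Matrix.diagonal (fun _ => e) + A ∈ dMax P n}

/-- The norm of an element of an operator system `(V, {C_n}, e)`: the infimum of the `t ≥ 0`
such that the `2 × 2` matrix with rows `(t e, v)` and `(v^*, t e)` lies in `C_2`. -/
noncomputable def operatorSystemNorm (C : ∀ n : ℕ, Set (Matrix (Fin n) (Fin n) V))
    (e v : V) : ℝ :=
  sInf {t : ℝ | 0 ≤ t ∧ !![(t : ℂ) • e, v; star v, (t : ℂ) • e] ∈ C 2}

/-- The norm of the operator system `OMAX(V) = (V, {C_n^max}, e)`. -/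
noncomputable def omaxNorm (P : Set V) (e v : V) : ℝ :=
  operatorSystemNorm (cMax P e) e v

/-- Unital positive linear maps from `(V, P, e)` to `B(H)`. -/
structure IsUnitalPositive (P : Set V) (e : V) {H : Type w} [NormedAddCommGroup H]
    [InnerProductSpace ℂ H] (φ : V →ₗ[ℂ] (H →L[ℂ] H)) : Prop where
  unital : φ e = 1
  positive : ∀ x ∈ P, (φ x).IsPositive

end

end OMax

namespace OMax

open scoped ComplexOrder InnerProductSpace ComplexStarModule

/-! If `v = ∑ λ_j v_j` has modulus `S = ∑ |λ_j| v_j ≤ te`, then summing the positive matrices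
`[[|λ_j|, λ_j], [conj λ_j, |λ_j|]] ⊗ v_j` and adding `te - S` on the diagonal gives the matrix that
defines the OMAX norm. Conversely, the off-diagonal entries of an element of `dMax P 2` form a
decomposition, and `2|a₀₁| ≤ a₀₀ + a₁₁` bounds its modulus by the mean of the two diagonals. Hence
the first equality. The same mean inequality for the forms `⟪φ(v_j) ξ, η⟫` shows that unital
positive maps do not exceed `decNorm`.

Attaining the norm is a duality argument (`exists_dominated_functional`): for `t < decNorm P e v`,
separating `(te, -v)` from `dominationCone` gives functionals with `|f| ≤ s` on the cone, `s e = 1`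
and `t ≤ |f v|`. Then `[[s, f], [f^*, s]]` is a positive map into `M_2(ℂ)`. Once `f` is shrunk
slightly, its value at `e` is invertible and it can be made unital. -/

/-- Separation of a point from a cone with an order unit by a normalised positive functional. -/
theorem exists_positive_functional_of_notMem {E : Type*} [AddCommGroup E] [Module ℝ E]
    (K : PointedCone ℝ E) (u y : E) (hu : u ∈ K) (hunit : ∀ z, ∃ a : ℝ, a • u + z ∈ K)
    (hy : y ∉ K) : ∃ g : E →ₗ[ℝ] ℝ, (∀ z ∈ K, 0 ≤ g z) ∧ g u = 1 ∧ g y ≤ 0 := by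
  have hsm : ∀ {c : ℝ} {z : E}, 0 ≤ c → z ∈ K → c • z ∈ K := fun {c z} hc hz =>
    K.smul_mem hc hz
  -- For `a < 0`, the case `c = 0` puts `-u`, hence all of `E`, in `K`; the case `c > 0` puts `y` in
  -- `K`.
  have hnu : ∀ a c : ℝ, 0 ≤ c → a • u + c • y ∈ K → 0 ≤ a := by
    intro a c hc h
    by_contra! ha
    rcases hc.eq_or_lt with rfl | hc
    · obtain ⟨b, hb⟩ := hunit y
      have hneg : -u ∈ K := by
        have := hsm (inv_nonneg.2 (neg_nonneg.2 ha.le)) h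
        have h2 : a⁻¹ * a = 1 := inv_mul_cancel₀ ha.ne
        simpa [smul_smul, h2] using this
      have hbu : (-b) • u ∈ K := by
        rcases le_total 0 b with hb0 | hb0
        · simpa using hsm hb0 hneg
        · exact hsm (neg_nonneg.2 hb0) hu
      exact hy (by simpa using K.add_mem hbu hb)
    · have h1 : c • y ∈ K := by
        simpa using K.add_mem (hsm (neg_nonneg.2 ha.le) hu) h
      have := hsm (inv_nonneg.2 hc.le) h1
      rw [smul_smul, inv_mul_cancel₀ hc.ne', one_smul] at this
      exact hy this
  have hu0 : u ≠ 0 := by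
    rintro rfl
    have := hnu (-1) 0 le_rfl (by simp)
    linarith
  -- `K' = K - ℝ₊ y`: positivity on `K'` forces `g (-y) ≥ 0`.
  let K' : PointedCone ℝ E :=
    { carrier := {z | ∃ c : ℝ, 0 ≤ c ∧ z + c • y ∈ K}
      add_mem' := by
        rintro a b ⟨c, hc, h⟩ ⟨d, hd, h'⟩
        refine ⟨c + d, add_nonneg hc hd, ?_⟩
        convert K.add_mem h h' using 1
        module
      zero_mem' := ⟨0, le_rfl, by simp⟩
      smul_mem' := by
        rintro ⟨r, hr⟩ a ⟨c, hc, h⟩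
        refine ⟨r * c, mul_nonneg hr hc, ?_⟩
        convert hsm hr h using 1
        rw [smul_add, smul_smul]
        rfl }
  obtain ⟨g, hg, hgK⟩ := riesz_extension K' (LinearPMap.mkSpanSingleton u (1 : ℝ) hu0)
    (by
      rintro ⟨x, hx⟩ ⟨c, hc, h⟩
      obtain ⟨a, rfl⟩ := Submodule.mem_span_singleton.1 hx
      rw [LinearPMap.mkSpanSingleton'_apply]
      simpa using hnu a c hc h)
    (by
      intro z
      obtain ⟨a, ha⟩ := hunit z
      exact ⟨⟨a • u, Submodule.mem_span_singleton.2 ⟨a, rfl⟩⟩, 0, le_rfl, by simpa using ha⟩)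
  refine ⟨g, fun z hz => hgK z ⟨0, le_rfl, by simpa using hz⟩, ?_, ?_⟩
  · have := hg ⟨u, Submodule.mem_span_singleton_self u⟩
    rwa [LinearPMap.mkSpanSingleton_apply] at this
  · have := hgK (-y) ⟨1, zero_le_one, by simp⟩
    simpa using this

/-! ### Mean inequalities for positive matrices and operators. -/

/-- `2 × 2` hermitian matrices with constant diagonal dominating the off-diagonal entry. -/
theorem posSemidef_of_norm_le {a : ℝ} {b : ℂ} (h : ‖b‖ ≤ a) :
    (!![(a : ℂ), b; star b, (a : ℂ)]).PosSemidef := by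
  obtain ⟨θ, hθ, hb⟩ : ∃ θ : ℂ, ‖θ‖ = 1 ∧ b = ‖b‖ * θ := by
    by_cases hb : b = 0
    · exact ⟨1, by simp, by simp [hb]⟩
    · have : (‖b‖ : ℂ) ≠ 0 := by simpa using hb
      exact ⟨b / ‖b‖, by simp [hb], by field_simp⟩
  -- The matrix is `‖b‖` times a rank-one projection-like term plus `(a - ‖b‖) • 1`.
  have h1 : (((‖b‖ : ℝ) : ℂ) • Matrix.vecMulVec ![θ, 1] (star ![θ, 1])).PosSemidef :=
    (Matrix.posSemidef_vecMulVec_self_star _).smul (by simp)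
  have h2 : (((a - ‖b‖ : ℝ) : ℂ) • (1 : Matrix (Fin 2) (Fin 2) ℂ)).PosSemidef :=
    Matrix.PosSemidef.one.smul (by exact_mod_cast sub_nonneg.2 h)
  have hθ2 : θ * star θ = 1 := by
    rw [Complex.star_def, Complex.mul_conj, Complex.normSq_eq_norm_sq, hθ]; simp
  have hsb : star b = ‖b‖ * star θ := by
    conv_lhs => rw [hb]
    simp
  convert h1.add h2 using 1
  ext i j
  simp only [Matrix.add_apply, Matrix.smul_apply, Matrix.vecMulVec_apply, Pi.star_apply]
  fin_cases i <;> fin_cases j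
  · have hθ3 : θ * (starRingEnd ℂ) θ = 1 := hθ2
    simp [hθ3]
  · simpa using hb
  · simpa using hsb
  · simp

theorem two_mul_norm_le_of_posSemidef {a : Matrix (Fin 2) (Fin 2) ℂ} (ha : a.PosSemidef) :
    2 * ‖a 0 1‖ ≤ (a 0 0).re + (a 1 1).re := by
  have hd : 0 ≤ a.det := ha.det_nonneg
  have h0 := Complex.nonneg_iff.1 (ha.diag_nonneg (i := 0))
  have h1 := Complex.nonneg_iff.1 (ha.diag_nonneg (i := 1))
  have h10 : a 1 0 = star (a 0 1) := (ha.isHermitian.apply 1 0).symm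
  rw [Matrix.det_fin_two, h10, Complex.star_def, Complex.mul_conj, Complex.normSq_eq_norm_sq]
    at hd
  have hre := (Complex.nonneg_iff.1 hd).1
  rw [Complex.sub_re, Complex.mul_re, ← h0.2, Complex.ofReal_re, zero_mul, sub_zero] at hre
  nlinarith [norm_nonneg (a 0 1), sq_nonneg ((a 0 0).re - (a 1 1).re)]

section

variable {H : Type w} [NormedAddCommGroup H] [InnerProductSpace ℂ H]

/-- Cauchy–Schwarz with the arithmetic-geometric mean inequality for a positive operator. -/
theorem two_mul_norm_inner_le_of_isPositive {T : H →L[ℂ] H} (hT : T.IsPositive) (ξ η : H) :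
    2 * ‖⟪T ξ, η⟫_ℂ‖ ≤ (⟪T ξ, ξ⟫_ℂ).re + (⟪T η, η⟫_ℂ).re := by
  obtain ⟨θ, hθ, hb⟩ : ∃ θ : ℂ, ‖θ‖ = 1 ∧ θ * ⟪T ξ, η⟫_ℂ = ‖⟪T ξ, η⟫_ℂ‖ := by
    by_cases hb : ⟪T ξ, η⟫_ℂ = 0
    · exact ⟨1, by simp, by simp [hb]⟩
    · have h0 : (‖⟪T ξ, η⟫_ℂ‖ : ℂ) ≠ 0 := by simpa using hb
      refine ⟨‖⟪T ξ, η⟫_ℂ‖ / ⟪T ξ, η⟫_ℂ, ?_, by field_simp⟩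
      have : ‖⟪T ξ, η⟫_ℂ‖ ≠ 0 := by simpa using hb
      simp [this]
  have h := hT.re_inner_nonneg_left (ξ - θ • η)
  have hsymm : ⟪T η, ξ⟫_ℂ = star ⟪T ξ, η⟫_ℂ := by
    rw [hT.inner_left_eq_inner_right, ← inner_conj_symm]; rfl
  have h1 : ⟪T (θ • η), ξ⟫_ℂ = ‖⟪T ξ, η⟫_ℂ‖ := by
    rw [map_smul, inner_smul_left, hsymm]
    have := congrArg star hb
    simpa using this
  have h2 : ⟪T ξ, θ • η⟫_ℂ = ‖⟪T ξ, η⟫_ℂ‖ := by rw [inner_smul_right, hb]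
  have h3 : ⟪T (θ • η), θ • η⟫_ℂ = ⟪T η, η⟫_ℂ := by
    rw [map_smul, inner_smul_left, inner_smul_right, ← mul_assoc, Complex.conj_mul', hθ]
    simp
  rw [map_sub, inner_sub_left, inner_sub_right, inner_sub_right, h1, h2, h3] at h
  simp at h
  linarith

end

/-! ### Decompositions, the OMAX norm and the upper bound for unital positive maps. -/

section

variable {V : Type u} [AddCommGroup V] [Module ℂ V]

/-- `S = ∑ |λ_j| x_j` is the modulus of some decomposition `v = ∑ λ_j x_j` with `x_j ∈ P`. -/
def IsDecModulus (P : Set V) (S v : V) : Prop :=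
  ∃ (k : ℕ) (l : Fin k → ℂ) (x : Fin k → V), (∀ j, x j ∈ P) ∧
    v = ∑ j, l j • x j ∧ S = ∑ j, ((‖l j‖ : ℝ) : ℂ) • x j

theorem decNorm_eq (P : Set V) (e v : V) :
    decNorm P e v = sInf {t : ℝ | ∃ S, IsDecModulus P S v ∧ t = orderNorm P e S} := by
  unfold decNorm
  congr 1
  ext t
  constructor
  · rintro ⟨k, l, x, hx, hv, ht⟩
    exact ⟨_, ⟨k, l, x, hx, hv, rfl⟩, ht⟩
  · rintro ⟨S, ⟨k, l, x, hx, hv, rfl⟩, ht⟩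
    exact ⟨k, l, x, hx, hv, ht⟩

namespace IsDecModulus

variable {P : Set V} {S S' v v' : V}

theorem zero : IsDecModulus P 0 0 :=
  ⟨0, Fin.elim0, Fin.elim0, fun j => j.elim0, by simp, by simp⟩

theorem single {x : V} (hx : x ∈ P) (l : ℂ) :
    IsDecModulus P (((‖l‖ : ℝ) : ℂ) • x) (l • x) :=
  ⟨1, fun _ => l, fun _ => x, fun _ => hx, by simp, by simp⟩

theorem add (h : IsDecModulus P S v) (h' : IsDecModulus P S' v') :
    IsDecModulus P (S + S') (v + v') := by
  obtain ⟨k, l, x, hx, rfl, rfl⟩ := h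
  obtain ⟨k', l', x', hx', rfl, rfl⟩ := h'
  refine ⟨k + k', Fin.append l l', Fin.append x x', fun j => ?_, ?_, ?_⟩
  · induction j using Fin.addCases with
    | left j => simpa using hx j
    | right j => simpa using hx' j
  · simp [Fin.sum_univ_add]
  · simp [Fin.sum_univ_add]

theorem smul (h : IsDecModulus P S v) (c : ℂ) :
    IsDecModulus P (((‖c‖ : ℝ) : ℂ) • S) (c • v) := by
  obtain ⟨k, l, x, hx, rfl, rfl⟩ := h
  refine ⟨k, fun j => c * l j, x, hx, ?_, ?_⟩
  · simp [Finset.smul_sum, smul_smul]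
  · simp only [Finset.smul_sum, smul_smul, norm_mul, Complex.ofReal_mul]

end IsDecModulus

theorem orderNorm_nonneg (P : Set V) (e x : V) : 0 ≤ orderNorm P e x :=
  Real.sInf_nonneg fun _ h => h.1

theorem orderNorm_le {P : Set V} {e x : V} {t : ℝ} (ht : 0 ≤ t) (h : x + (t : ℂ) • e ∈ P)
    (h' : (t : ℂ) • e - x ∈ P) : orderNorm P e x ≤ t :=
  csInf_le ⟨0, fun _ h => h.1⟩ ⟨ht, h, h'⟩

namespace IsAOUSpace

variable [StarAddMonoid V] {P : Set V} {e : V}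

theorem zero_mem (hV : IsAOUSpace P e) : (0 : V) ∈ P := by
  obtain ⟨x, hx⟩ := hV.nonempty
  simpa using hV.smul_mem 0 le_rfl x hx

theorem unit_mem (hV : IsAOUSpace P e) : e ∈ P := by
  obtain ⟨r, hr, h⟩ := hV.order_unit 0 (star_zero V)
  have := hV.smul_mem r⁻¹ (inv_nonneg.2 hr.le) _ h
  have hr' : (r : ℂ) ≠ 0 := by exact_mod_cast hr.ne'
  simpa only [sub_zero, smul_smul, Complex.ofReal_inv, inv_mul_cancel₀ hr', one_smul] using this

theorem sum_mem (hV : IsAOUSpace P e) {ι : Type*} (s : Finset ι) {f : ι → V}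
    (h : ∀ i ∈ s, f i ∈ P) : ∑ i ∈ s, f i ∈ P :=
  Finset.sum_induction f (· ∈ P) (fun a b ha hb => hV.add_mem a ha b hb) hV.zero_mem h

theorem mem_of_isDecModulus (hV : IsAOUSpace P e) {S v : V} (h : IsDecModulus P S v) :
    S ∈ P := by
  obtain ⟨k, l, x, hx, -, rfl⟩ := h
  exact hV.sum_mem _ fun j _ => hV.smul_mem _ (norm_nonneg _) _ (hx j)

theorem decNorm_le (hV : IsAOUSpace P e) {S v : V} {t : ℝ} (h : IsDecModulus P S v)
    (ht : 0 ≤ t) (hS : (t : ℂ) • e - S ∈ P) : decNorm P e v ≤ t := by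
  rw [decNorm_eq]
  have hle : orderNorm P e S ≤ t := orderNorm_le ht ?_ hS
  · refine (csInf_le ⟨0, ?_⟩ ?_).trans hle
    · rintro _ ⟨S, -, rfl⟩
      exact orderNorm_nonneg P e S
    · exact ⟨S, h, rfl⟩
  · exact hV.add_mem _ (hV.mem_of_isDecModulus h) _ (hV.smul_mem t ht e hV.unit_mem)

theorem exists_isDecModulus_of_star_eq (hV : IsAOUSpace P e) {h : V} (hh : star h = h) :
    ∃ S, IsDecModulus P S h := by
  obtain ⟨r, hr, hrh⟩ := hV.order_unit h hh
  have hdec := (IsDecModulus.single hV.unit_mem (r : ℂ)).add (IsDecModulus.single hrh (-1))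
  have hsum : (r : ℂ) • e + (-1 : ℂ) • ((r : ℂ) • e - h) = h := by module
  exact ⟨_, hsum ▸ hdec⟩

theorem isDecModulus_of_mem_dMax (hV : IsAOUSpace P e) {v : V} {t : ℝ} {w : V}
    (h : !![(t : ℂ) • e, v; w, (t : ℂ) • e] ∈ dMax P 2) :
    ∃ S, IsDecModulus P S v ∧ (t : ℂ) • e - S ∈ P := by
  obtain ⟨k, a, x, ha, hx, h⟩ := h
  have h00 : (t : ℂ) • e = ∑ i, a i 0 0 • x i := by
    simpa [Matrix.sum_apply] using congr_fun (congr_fun h 0) 0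
  have h01 : v = ∑ i, a i 0 1 • x i := by
    simpa [Matrix.sum_apply] using congr_fun (congr_fun h 0) 1
  have h11 : (t : ℂ) • e = ∑ i, a i 1 1 • x i := by
    simpa [Matrix.sum_apply] using congr_fun (congr_fun h 1) 1
  refine ⟨_, ⟨k, fun i => a i 0 1, x, hx, h01, rfl⟩, ?_⟩
  have hre : ∀ i (p : Fin 2), a i p p = ((a i p p).re : ℂ) := fun i p =>
    (Complex.ofReal_re _ ▸ Complex.eq_re_of_ofReal_le (r := 0) (by simpa using (ha i).diag_nonneg))
  have key : (t : ℂ) • e - ∑ i, ((‖a i 0 1‖ : ℝ) : ℂ) • x i =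
      ∑ i, ((((a i 0 0).re + (a i 1 1).re) / 2 - ‖a i 0 1‖ : ℝ) : ℂ) • x i := by
    have : (t : ℂ) • e = (1 / 2 : ℂ) • ((t : ℂ) • e + (t : ℂ) • e) := by module
    rw [this]
    nth_rewrite 1 [h00]
    rw [h11, ← Finset.sum_add_distrib, Finset.smul_sum, ← Finset.sum_sub_distrib]
    refine Finset.sum_congr rfl fun i _ => ?_
    rw [hre i 0, hre i 1]
    push_cast
    module
  rw [key]
  refine hV.sum_mem _ fun i _ => hV.smul_mem _ ?_ _ (hx i)
  linarith [two_mul_norm_le_of_posSemidef (ha i)]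

variable [StarModule ℂ V]

/-- Keeps the infimum in `decNorm` over a nonempty set, so the default value of `sInf` never
intervenes. -/
theorem exists_isDecModulus (hV : IsAOUSpace P e) (v : V) : ∃ S, IsDecModulus P S v := by
  obtain ⟨S, hS⟩ := hV.exists_isDecModulus_of_star_eq (h := (ℜ v : V)) (ℜ v).2
  obtain ⟨S', hS'⟩ := hV.exists_isDecModulus_of_star_eq (h := (ℑ v : V)) (ℑ v).2
  have hdec := hS.add (hS'.smul Complex.I)
  rw [realPart_add_I_smul_imaginaryPart v] at hdec
  exact ⟨_, hdec⟩

/-- Approximate minimisers of the decomposition norm. -/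
theorem exists_of_decNorm_lt (hV : IsAOUSpace P e) {v : V} {r : ℝ} (h : decNorm P e v < r) :
    ∃ (S : V) (t : ℝ), IsDecModulus P S v ∧ 0 ≤ t ∧ t < r ∧ (t : ℂ) • e - S ∈ P := by
  rw [decNorm_eq] at h
  obtain ⟨S₀, hS₀⟩ := hV.exists_isDecModulus v
  obtain ⟨_, ⟨S, hS, rfl⟩, hlt⟩ := exists_lt_of_csInf_lt (by exact ⟨_, S₀, hS₀, rfl⟩) h
  have hSP := hV.mem_of_isDecModulus hS
  obtain ⟨q, hq, hqS⟩ := hV.order_unit S (hV.hermitian S hSP)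
  have hne : {t : ℝ | 0 ≤ t ∧ S + (t : ℂ) • e ∈ P ∧ (t : ℂ) • e - S ∈ P}.Nonempty :=
    ⟨q, hq.le, hV.add_mem _ hSP _ (hV.smul_mem q hq.le e hV.unit_mem), hqS⟩
  obtain ⟨t, ⟨ht, -, htS⟩, htr⟩ := exists_lt_of_csInf_lt hne hlt
  exact ⟨S, t, hS, ht, htr, htS⟩

theorem mem_cMax_of_isDecModulus (hV : IsAOUSpace P e) {S v : V} {t : ℝ}
    (h : IsDecModulus P S v) (hS : (t : ℂ) • e - S ∈ P) :
    !![(t : ℂ) • e, v; star v, (t : ℂ) • e] ∈ cMax P e 2 := by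
  intro r hr
  obtain ⟨k, l, x, hx, rfl, rfl⟩ := h
  -- The extra term `1 ⊗ (re + te - S)` fills the diagonal up to `(r + t)e`.
  refine ⟨k + 1, Fin.cons 1 fun j => !![((‖l j‖ : ℝ) : ℂ), l j; star (l j), ((‖l j‖ : ℝ) : ℂ)],
    Fin.cons ((r : ℂ) • e + ((t : ℂ) • e - ∑ j, ((‖l j‖ : ℝ) : ℂ) • x j)) x,
    fun j => ?_, fun j => ?_, ?_⟩
  · induction j using Fin.cases with
    | zero => simpa using Matrix.PosSemidef.one
    | succ j => simpa using posSemidef_of_norm_le le_rfl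
  · induction j using Fin.cases with
    | zero => exact hV.add_mem _ (hV.smul_mem r hr.le e hV.unit_mem) _ hS
    | succ j => simpa using hx j
  · rw [Fin.sum_univ_succ]
    ext i j
    fin_cases i <;> fin_cases j <;>
      simp [Matrix.sum_apply, star_sum, fun j => hV.hermitian _ (hx j), add_assoc]

theorem decNorm_eq_omaxNorm (hV : IsAOUSpace P e) (v : V) :
    decNorm P e v = omaxNorm P e v := by
  have hbdd : BddBelow {t : ℝ | 0 ≤ t ∧ !![(t : ℂ) • e, v; star v, (t : ℂ) • e] ∈ cMax P e 2} :=
    ⟨0, fun _ h => h.1⟩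
  apply le_antisymm
  · obtain ⟨S, t, hS, ht, -, htS⟩ := hV.exists_of_decNorm_lt (lt_add_one (decNorm P e v))
    refine le_csInf ⟨t, ht, hV.mem_cMax_of_isDecModulus hS htS⟩ ?_
    rintro t ⟨ht, h⟩
    -- Passing from `cMax` to `dMax` costs an arbitrarily small `r`.
    refine le_of_forall_pos_le_add fun r hr => ?_
    have hr' : !![((t + r : ℝ) : ℂ) • e, v; star v, ((t + r : ℝ) : ℂ) • e] ∈ dMax P 2 := by
      convert h r hr using 1
      ext i j
      fin_cases i <;> fin_cases j <;> simp [add_smul, add_comm]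
    obtain ⟨S, hS, htS⟩ := hV.isDecModulus_of_mem_dMax hr'
    exact hV.decNorm_le hS (add_nonneg ht hr.le) htS
  · refine le_of_forall_gt_imp_ge_of_dense fun r hr => ?_
    obtain ⟨S, t, hS, ht, htr, htS⟩ := hV.exists_of_decNorm_lt hr
    exact (csInf_le hbdd ⟨ht, hV.mem_cMax_of_isDecModulus hS htS⟩).trans htr.le

theorem norm_le_decNorm (hV : IsAOUSpace P e) {H : Type w} [NormedAddCommGroup H]
    [InnerProductSpace ℂ H] {φ : V →ₗ[ℂ] (H →L[ℂ] H)} (hφ : IsUnitalPositive P e φ) (v : V) :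
    ‖φ v‖ ≤ decNorm P e v := by
  refine le_of_forall_gt_imp_ge_of_dense fun r hr => ?_
  obtain ⟨S, t, hS, ht, htr, htS⟩ := hV.exists_of_decNorm_lt hr
  refine le_trans (ContinuousLinearMap.opNorm_le_of_re_inner_le (𝕜 := ℂ) ht ?_) htr.le
  intro ξ η hξ hη
  have hb : ∀ ζ : H, ‖ζ‖ = 1 → (⟪φ S ζ, ζ⟫_ℂ).re ≤ t := by
    intro ζ hζ
    have := (hφ.positive _ htS).re_inner_nonneg_left ζ
    simp [hφ.unital, inner_sub_left, inner_self_eq_norm_sq_to_K, hζ] at this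
    exact this
  obtain ⟨k, l, x, hx, rfl, rfl⟩ := hS
  have hsum : ∀ ζ : H, (⟪φ (∑ j, ((‖l j‖ : ℝ) : ℂ) • x j) ζ, ζ⟫_ℂ).re =
      ∑ j, ‖l j‖ * (⟪φ (x j) ζ, ζ⟫_ℂ).re := by
    intro ζ
    simp [map_sum]
  have h1 : ‖⟪φ (∑ j, l j • x j) ξ, η⟫_ℂ‖ ≤ ∑ j, ‖l j‖ * ‖⟪φ (x j) ξ, η⟫_ℂ‖ := by
    rw [map_sum]
    simp only [map_smul, _root_.sum_apply, sum_inner,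
      _root_.smul_apply, inner_smul_left]
    refine (norm_sum_le _ _).trans (le_of_eq ?_)
    simp
  have h2 : 2 * ∑ j, ‖l j‖ * ‖⟪φ (x j) ξ, η⟫_ℂ‖ ≤
      ∑ j, ‖l j‖ * (⟪φ (x j) ξ, ξ⟫_ℂ).re + ∑ j, ‖l j‖ * (⟪φ (x j) η, η⟫_ℂ).re := by
    rw [Finset.mul_sum, ← Finset.sum_add_distrib]
    refine Finset.sum_le_sum fun j _ => ?_
    have := mul_le_mul_of_nonneg_left
      (two_mul_norm_inner_le_of_isPositive (hφ.positive _ (hx j)) ξ η) (norm_nonneg (l j))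
    linarith
  rw [← hsum, ← hsum] at h2
  have := hb ξ hξ
  have := hb η hη
  have := Complex.re_le_norm ⟪φ (∑ j, l j • x j) ξ, η⟫_ℂ
  simp only [RCLike.re_to_complex] at *
  linarith

end IsAOUSpace

end

/-! ### Normalised positive maps into `2 × 2` matrices. -/

section

variable {V : Type u} [AddCommGroup V] [Module ℂ V]

/-- A positive map with invertible value at `e` can be normalised to a unital positive map. -/
theorem exists_isUnitalPositive_of_isUnit {P : Set V} {e : V} (he : e ∈ P)
    {H : Type w} [NormedAddCommGroup H] [InnerProductSpace ℂ H] [CompleteSpace H]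
    (ψ : V →ₗ[ℂ] (H →L[ℂ] H)) (hψ : ∀ x ∈ P, (ψ x).IsPositive) (hu : IsUnit (ψ e)) :
    ∃ φ : V →ₗ[ℂ] (H →L[ℂ] H), IsUnitalPositive P e φ ∧
      ∀ (v : V) (ξ η : H), ⟪ξ, ψ e ξ⟫_ℂ = 1 → ⟪η, ψ e η⟫_ℂ = 1 → ‖⟪ξ, ψ v η⟫_ℂ‖ ≤ ‖φ v‖ := by
  have hpos : IsStrictlyPositive (ψ e) :=
    hu.isStrictlyPositive ((ContinuousLinearMap.nonneg_iff_isPositive _).2 (hψ e he))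
  -- With `ψ e = y^* y` and `z = y⁻¹`, the map `z^* ψ z` is unital; `y` sends vectors with `⟪ξ, ψ e
  -- ξ⟫ = 1` to unit vectors.
  obtain ⟨_, ⟨y, rfl⟩, hy⟩ := CStarAlgebra.isStrictlyPositive_iff_eq_star_mul_self.1 hpos
  let z : H →L[ℂ] H := (↑y⁻¹ : H →L[ℂ] H)
  have hyz : (y : H →L[ℂ] H) * z = 1 := y.mul_inv
  have hzy : z * (y : H →L[ℂ] H) = 1 := y.inv_mul
  have hzy' : star (y : H →L[ℂ] H) * star z = 1 := by rw [← star_mul, hzy, star_one]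
  have hyz' : star z * star (y : H →L[ℂ] H) = 1 := by rw [← star_mul, hyz, star_one]
  let φ : V →ₗ[ℂ] (H →L[ℂ] H) :=
    (LinearMap.mulLeft ℂ (star z) ∘ₗ LinearMap.mulRight ℂ z) ∘ₗ ψ
  have hφ : ∀ x, φ x = star z * (ψ x * z) := fun x => rfl
  have hφψ : ∀ x, ψ x = star (y : H →L[ℂ] H) * φ x * y := by
    intro x
    rw [hφ, ← mul_assoc, hzy', one_mul, mul_assoc, hzy, mul_one]
  have hnorm : ∀ ξ : H, ⟪ξ, ψ e ξ⟫_ℂ = 1 → ‖(y : H →L[ℂ] H) ξ‖ = 1 := by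
    intro ξ hξ
    rw [hy, ContinuousLinearMap.star_eq_adjoint, mul_apply_eq_comp,
      ContinuousLinearMap.adjoint_inner_right, inner_self_eq_norm_sq_to_K] at hξ
    have : ‖(y : H →L[ℂ] H) ξ‖ ^ 2 = 1 := Complex.ofReal_injective (by simpa using hξ)
    exact (pow_eq_one_iff_of_nonneg (norm_nonneg _) two_ne_zero).1 this
  refine ⟨φ, ⟨?_, fun x hx => ?_⟩, fun v ξ η hξ hη => ?_⟩
  · rw [hφ, hy, mul_assoc, hyz, mul_one, hyz']
  · have := (hψ x hx).adjoint_conj z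
    rwa [← ContinuousLinearMap.star_eq_adjoint] at this
  · rw [hφψ, ContinuousLinearMap.star_eq_adjoint, mul_apply_eq_comp, mul_apply_eq_comp,
      ContinuousLinearMap.adjoint_inner_right]
    calc _ ≤ ‖(y : H →L[ℂ] H) ξ‖ * ‖φ v ((y : H →L[ℂ] H) η)‖ := norm_inner_le_norm _ _
      _ ≤ ‖(y : H →L[ℂ] H) ξ‖ * (‖φ v‖ * ‖(y : H →L[ℂ] H) η‖) := by
        gcongr
        exact (φ v).le_opNorm _
      _ = ‖φ v‖ := by rw [hnorm ξ hξ, hnorm η hη]; ring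

variable [StarAddMonoid V] [StarModule ℂ V]

/-- The linear map `x ↦ [[s x, f x], [conj (f x^*), s x]]` into `2 × 2` matrices. -/
noncomputable def twoByTwo (s f : V →ₗ[ℂ] ℂ) : V →ₗ[ℂ] Matrix (Fin 2) (Fin 2) ℂ where
  toFun x := !![s x, f x; star (f (star x)), s x]
  map_add' x y := by ext i j; fin_cases i <;> fin_cases j <;> simp
  map_smul' c x := by ext i j; fin_cases i <;> fin_cases j <;> simp

/-- A pair of functionals with `|f| ≤ s` on the cone is an off-diagonal and diagonal entry of a
positive map into `2 × 2` matrices; normalising it bounds `|f v|`. -/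
theorem exists_isUnitalPositive_of_dominated {P : Set V} {e : V} (hV : IsAOUSpace P e)
    (s f : V →ₗ[ℂ] ℂ) (σ : V → ℝ) (hσ : ∀ x ∈ P, s x = σ x) (hf : ∀ x ∈ P, ‖f x‖ ≤ σ x)
    (hse : σ e = 1) (hfe : ‖f e‖ < 1) (v : V) :
    ∃ φ : V →ₗ[ℂ] (EuclideanSpace ℂ (ULift.{w} (Fin 2)) →L[ℂ]
        EuclideanSpace ℂ (ULift.{w} (Fin 2))),
      IsUnitalPositive P e φ ∧ ‖f v‖ ≤ ‖φ v‖ := by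
  let T := Matrix.toEuclideanCLM (n := ULift.{w} (Fin 2)) (𝕜 := ℂ)
  let ψ : V →ₗ[ℂ] (EuclideanSpace ℂ (ULift.{w} (Fin 2)) →L[ℂ]
      EuclideanSpace ℂ (ULift.{w} (Fin 2))) :=
    (T.toAlgEquiv.toLinearMap ∘ₗ
      (Matrix.reindexLinearEquiv ℂ ℂ Equiv.ulift.symm Equiv.ulift.symm).toLinearMap) ∘ₗ twoByTwo s f
  have hψ : ∀ x, ψ x = T ((twoByTwo s f x).submatrix ULift.down ULift.down) := fun x => rfl
  have hmat : ∀ x ∈ P, twoByTwo s f x = !![(σ x : ℂ), f x; star (f x), (σ x : ℂ)] := by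
    intro x hx
    rw [← hσ x hx]
    conv_rhs => rw [← hV.hermitian x hx]
    simp [twoByTwo, hV.hermitian x hx]
  have hpos : ∀ x ∈ P, (ψ x).IsPositive := by
    intro x hx
    rw [hψ, ← ContinuousLinearMap.isPositive_toLinearMap_iff,
      Matrix.coe_toEuclideanCLM_eq_toEuclideanLin, Matrix.isPositive_toEuclideanLin_iff, hmat x hx]
    exact (posSemidef_of_norm_le (hf x hx)).submatrix _
  -- The determinant is `1 - ‖f e‖²`, nonzero because `‖f e‖ < 1` is strict.
  have hunit : IsUnit (ψ e) := by
    rw [hψ]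
    refine IsUnit.map T ?_
    rw [Matrix.isUnit_iff_isUnit_det, show (ULift.down : ULift.{w} (Fin 2) → Fin 2) =
      Equiv.ulift from rfl, Matrix.det_submatrix_equiv_self, hmat e hV.unit_mem, Matrix.det_fin_two,
      isUnit_iff_ne_zero]
    simp only [hse, Matrix.of_apply, Matrix.cons_val', Matrix.cons_val_zero, Matrix.cons_val_one,
      Matrix.cons_val_fin_one, Complex.star_def, Complex.mul_conj, Complex.normSq_eq_norm_sq]
    rw [Complex.ofReal_one, one_mul, sub_ne_zero]
    norm_cast
    nlinarith [norm_nonneg (f e)]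
  have hentry : ∀ x (i j : Fin 2), ⟪EuclideanSpace.single (ULift.up i) (1 : ℂ),
      ψ x (EuclideanSpace.single (ULift.up j) (1 : ℂ))⟫_ℂ = twoByTwo s f x i j := by
    intro x i j
    rw [EuclideanSpace.inner_single_left, hψ, Matrix.ofLp_toEuclideanCLM]
    simp
  obtain ⟨φ, hφ, hle⟩ := exists_isUnitalPositive_of_isUnit hV.unit_mem ψ hpos hunit
  refine ⟨φ, hφ, ?_⟩
  have := hle v (EuclideanSpace.single (ULift.up 0) (1 : ℂ))
    (EuclideanSpace.single (ULift.up 1) (1 : ℂ))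
    (by rw [hentry, hmat e hV.unit_mem, hse]; simp)
    (by rw [hentry, hmat e hV.unit_mem, hse]; simp)
  rw [hentry] at this
  simpa [twoByTwo] using this

/-! ### Dominated functionals by separation. -/

namespace IsAOUSpace

variable {P : Set V} {e : V}

/-- The cone of pairs `(h, v)` such that the real part of `h` dominates the modulus of a
decomposition of `v`. -/
def dominationCone (hV : IsAOUSpace P e) : PointedCone ℝ (V × V) where
  carrier := {z | ∃ S, IsDecModulus P S z.2 ∧ (ℜ z.1 : V) - S ∈ P}
  zero_mem' := ⟨0, IsDecModulus.zero, by simpa using hV.zero_mem⟩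
  add_mem' := by
    rintro a b ⟨S, hS, h⟩ ⟨S', hS', h'⟩
    refine ⟨S + S', hS.add hS', ?_⟩
    convert hV.add_mem _ h _ h' using 1
    simp only [Prod.fst_add, map_add, AddSubgroup.coe_add]
    abel
  smul_mem' := by
    rintro ⟨r, hr⟩ a ⟨S, hS, h⟩
    refine ⟨(r : ℂ) • S, ?_, ?_⟩
    · have := hS.smul (r : ℂ)
      rw [Complex.norm_of_nonneg hr] at this
      rwa [Complex.coe_smul r a.2] at this
    · convert hV.smul_mem r hr _ h using 1
      rw [smul_sub, Complex.coe_smul, Complex.coe_smul, Prod.smul_fst]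
      congr 1
      change (ℜ (r • a.1) : V) = _
      simp

theorem mem_dominationCone (hV : IsAOUSpace P e) {z : V × V} :
    z ∈ hV.dominationCone ↔ ∃ S, IsDecModulus P S z.2 ∧ (ℜ z.1 : V) - S ∈ P :=
  Iff.rfl

theorem realPart_coe_of_mem (hV : IsAOUSpace P e) {x : V} (hx : x ∈ P) : (ℜ x : V) = x :=
  IsSelfAdjoint.coe_realPart (hV.hermitian x hx)

/-- Below the decomposition norm there are functionals `|f| ≤ s` on `P` with `s e = 1` and
`|f v|` at least the given value. -/
theorem exists_dominated_functional (hV : IsAOUSpace P e) {v : V} {t : ℝ} (ht : 0 ≤ t)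
    (h : t < decNorm P e v) :
    ∃ (s f : V →ₗ[ℂ] ℂ) (σ : V → ℝ), (∀ x ∈ P, s x = σ x) ∧ (∀ x ∈ P, ‖f x‖ ≤ σ x) ∧
      σ e = 1 ∧ t ≤ ‖f v‖ := by
  have hsingle : ∀ x ∈ P, ∀ l : ℂ, (‖l‖ • x, l • x) ∈ hV.dominationCone := by
    intro x hx l
    refine hV.mem_dominationCone.2 ⟨_, IsDecModulus.single hx l, ?_⟩
    have := hV.realPart_coe_of_mem hx
    simpa [this] using hV.zero_mem
  obtain ⟨g, hgK, hge, hgv⟩ := exists_positive_functional_of_notMem hV.dominationCone (e, 0)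
    (t • e, -v) (by simpa using hV.mem_dominationCone.2 ⟨0, IsDecModulus.zero, by
      simpa [hV.realPart_coe_of_mem hV.unit_mem] using hV.unit_mem⟩)
    (by
      rintro ⟨x, y⟩
      obtain ⟨S, hS⟩ := hV.exists_isDecModulus y
      have hx : star (S - (ℜ x : V)) = S - ℜ x := by
        rw [star_sub, hV.hermitian S (hV.mem_of_isDecModulus hS), (ℜ x).2]
      obtain ⟨a, -, ha⟩ := hV.order_unit _ hx
      refine ⟨a, hV.mem_dominationCone.2 ⟨S, by simpa using hS, ?_⟩⟩
      convert ha using 1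
      simp [hV.realPart_coe_of_mem hV.unit_mem]
      abel)
    (by
      rintro ⟨S, hS, hSt⟩
      have hS' := hS.smul (-1)
      simp only [norm_neg, norm_one, Complex.ofReal_one, one_smul, neg_smul, neg_neg] at hS'
      refine absurd (hV.decNorm_le hS' ht ?_) (not_le.2 h)
      simpa [hV.realPart_coe_of_mem hV.unit_mem] using hSt)
  let g₁ : Module.Dual ℝ V := g ∘ₗ LinearMap.inl ℝ V V
  let g₂ : Module.Dual ℝ V := g ∘ₗ LinearMap.inr ℝ V V
  have hg : ∀ x y, g (x, y) = g₁ x + g₂ y := by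
    intro x y
    simp [g₁, g₂, ← map_add]
  -- The cone ignores the imaginary part of the first coordinate, so it contains `(±ix, 0)`; this
  -- makes the complex extension of `g₁` real on `P`.
  have hskew : ∀ x ∈ P, g₁ (Complex.I • x) = 0 := by
    intro x hx
    have hx0 : (ℑ x : V) = 0 := by
      have := (IsSelfAdjoint.imaginaryPart (hV.hermitian x hx))
      simp [this]
    have h1 : (Complex.I • x, (0 : V)) ∈ hV.dominationCone :=
      hV.mem_dominationCone.2 ⟨0, IsDecModulus.zero, by
        simpa [realPart_I_smul, hx0] using hV.zero_mem⟩
    have h2 : (-(Complex.I • x), (0 : V)) ∈ hV.dominationCone :=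
      hV.mem_dominationCone.2 ⟨0, IsDecModulus.zero, by
        simpa [realPart_I_smul, hx0] using hV.zero_mem⟩
    have h1' := hgK _ h1
    have h2' := hgK _ h2
    simp only [hg, map_zero, add_zero, map_neg] at h1' h2'
    linarith
  refine ⟨g₁.extendRCLike, g₂.extendRCLike, g₁, fun x hx => ?_, fun x hx => ?_, hge, ?_⟩
  · rw [Module.Dual.extendRCLike_apply]
    have := hskew x hx
    simp [this]
  · set f : V →ₗ[ℂ] ℂ := g₂.extendRCLike with hf
    have hsq := Module.Dual.norm_extendRCLike_apply_sq (𝕜 := ℂ) g₂ x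
    rw [← hf] at hsq
    -- The coefficient `-conj (f x)` yields `‖f x‖² ≤ ‖f x‖ * g₁ x`; if `f x = 0`, coefficients `±1`
    -- give `0 ≤ g₁ x`.
    have hpos := hgK _ (hsingle x hx (-(starRingEnd ℂ) (f x)))
    rw [hg, neg_smul, map_neg, ← hsq, norm_neg, RCLike.norm_conj, map_smul, smul_eq_mul] at hpos
    rcases (norm_nonneg (f x)).eq_or_lt with h0 | h0
    · rw [← h0]
      have := hgK _ (hsingle x hx 1)
      have h2 := hgK _ (hsingle x hx (-1))
      simp only [norm_one, one_smul, norm_neg, neg_smul, hg, map_neg] at this h2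
      linarith
    · nlinarith
  · have h1 : t ≤ g₂ v := by
      rw [hg, map_neg, map_smul] at hgv
      have : g₁ e = 1 := hge
      simp only [this, smul_eq_mul, mul_one] at hgv
      linarith
    have h2 := Complex.re_le_norm ((g₂.extendRCLike : Module.Dual ℂ V) v)
    have h3 := Module.Dual.re_extendRCLike_apply (𝕜 := ℂ) g₂ v
    exact h1.trans (h3 ▸ h2)

end IsAOUSpace

end

end OMax

theorem mainTheorem7 {V : Type u} [AddCommGroup V] [Module ℂ V] [StarAddMonoid V]
    [StarModule ℂ V] (P : Set V) (e : V) (hV : OMax.IsAOUSpace P e) (v : V) :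
    OMax.decNorm P e v = OMax.omaxNorm P e v ∧
    IsLUB {t : ℝ | ∃ (H : Type w) (_ : NormedAddCommGroup H) (_ : InnerProductSpace ℂ H)
        (_ : CompleteSpace H) (φ : V →ₗ[ℂ] (H →L[ℂ] H)),
        OMax.IsUnitalPositive P e φ ∧ t = ‖φ v‖}
      (OMax.omaxNorm P e v) := by
  refine ⟨hV.decNorm_eq_omaxNorm v, ?_⟩
  rw [← hV.decNorm_eq_omaxNorm v]
  refine ⟨?_, fun b hb => ?_⟩
  · rintro _ ⟨H, _, _, _, φ, hφ, rfl⟩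
    exact hV.norm_le_decNorm hφ v
  · have hb0 : 0 ≤ b := by
      -- On the zero Hilbert space `0 = 1`, so the zero map is unital and contributes the value `0`.
      refine hb ⟨EuclideanSpace ℂ (ULift.{w} (Fin 0)), inferInstance, inferInstance, inferInstance,
        0, ⟨Subsingleton.elim _ _, fun x _ => ?_⟩, by simp⟩
      exact ContinuousLinearMap.isPositive_zero
    by_contra! hlt
    obtain ⟨t, hbt, ht⟩ := exists_between hlt
    have ht0 : 0 < t := hb0.trans_lt hbt
    obtain ⟨s, f, σ, hσ, hf, hσe, hfv⟩ := hV.exists_dominated_functional ht0.le ht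
    -- `c < 1` makes `‖c f e‖ < 1`, while `c > b / t` keeps `‖c f v‖` above `b`.
    obtain ⟨c, hbc, hc1⟩ := exists_between ((div_lt_one ht0).2 hbt)
    have hc0 : 0 ≤ c := (div_nonneg hb0 ht0.le).trans hbc.le
    have hcf : ∀ x, ‖((c : ℂ) • f) x‖ = c * ‖f x‖ := fun x => by
      rw [LinearMap.smul_apply, norm_smul, Complex.norm_of_nonneg hc0]
    obtain ⟨φ, hφ, hle⟩ := OMax.exists_isUnitalPositive_of_dominated.{u, w} hV s ((c : ℂ) • f) σ hσ
      (fun x hx => by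
        rw [hcf]
        exact (mul_le_of_le_one_left (norm_nonneg _) hc1.le).trans (hf x hx)) hσe
      (by
        rw [hcf]
        have := hf e hV.unit_mem
        rw [hσe] at this
        nlinarith [norm_nonneg (f e)]) v
    have hbφ : ‖φ v‖ ≤ b := hb ⟨_, inferInstance, inferInstance, inferInstance, φ, hφ, rfl⟩
    rw [hcf] at hle
    have h1 : b < c * t := (div_lt_iff₀ ht0).1 hbc
    have h2 : c * t ≤ c * ‖f v‖ := mul_le_mul_of_nonneg_left hfv hc0
    linarith
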